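/- Let $n\ge 1$ and let $C=[-\tfrac12,\tfrac12]^n\subset\mathbb{R}^n$ be the unit $n$-cube. For a unit vector $u=(u_1,\dots,u_n)\in\mathbb{R}^n$, let $\mathrm{vl}(u)$ denote the $(n-1)$-dimensional volume (Lebesgue measure in $u^\perp$) of the orthogonal projection of $C$ onto the hyperplane $u^\perp$. Then $\mathrm{vl}(u)=|u_1|+\dots+|u_n|$ for every unit vector $u$. If $U$ is a random vector uniformly distributed on the unit sphere of $\mathbb{R}^n$, then $\mathrm{vl}(U)$ and $\mathrm{vl}(U)^2$ are integrable and $$\mathbb{E}(\mathrm{vl}(U))=\frac{n}{\sqrt{\pi}}\,\frac{\Gamma\left(\frac n2\right)}{\Gamma\left(\frac{n+1}2\right)},\qquad \mathbb{E}(\mathrm{vl}(U)^2)=1+\frac{2(n-1)}{\pi}.$$ Moreover, over all unit vectors $u\in\mathbb{R}^n$, $\max \mathrm{vl}(u)=\sqrt n$ and $\min \mathrm{vl}(u)=1$, both being attained. In particular, for $n=4$ and $u=(x,y,z,w)$ we have $\mathrm{vl}(u)=|x|+|y|+|z|+|w|$, and $$\mathbb{E}(\mathrm{vl}(U))=\frac{16}{3\pi},\qquad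 \mathbb{E}(\mathrm{vl}(U)^2)=1+\frac6\pi .$$ -/

import Mathlib

open MeasureTheory ProbabilityTheory

noncomputable section

/-- The unit `n`-cube with edges of length one, centred at the origin of Euclidean `n`-space. -/
def unitCube (n : ℕ) : Set (EuclideanSpace ℝ (Fin n)) :=
  {x | ∀ i, |x i| ≤ 1 / 2}

/-- The hyperplane of all vectors orthogonal to `u`. -/
abbrev hyperplane {n : ℕ} (u : EuclideanSpace ℝ (Fin n)) :
    Submodule ℝ (EuclideanSpace ℝ (Fin n)) :=
  (Submodule.span ℝ {u})ᗮ

/-- The orthogonal projection of the unit `n`-cube to the hyperplane orthogonal to `u`,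
as a subset of that hyperplane. -/
def projectedCube {n : ℕ} (u : EuclideanSpace ℝ (Fin n)) : Set (hyperplane u) :=
  (hyperplane u).orthogonalProjectionOnto '' unitCube n

/-- The `(n - 1)`-dimensional volume of the orthogonal projection of the unit `n`-cube to the
hyperplane orthogonal to `u`. Here `volume` is the Lebesgue measure of the inner product space
`hyperplane u`: the unit box of an orthonormal basis of the hyperplane has measure one. -/
def vl {n : ℕ} (u : EuclideanSpace ℝ (Fin n)) : ℝ :=
  (volume (projectedCube u)).toReal

/-- The random point `U` is uniformly distributed on the unit sphere of Euclidean `n`-space: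
its law is the normalized surface measure. -/
def IsUniformOnSphere {n : ℕ} {Ω : Type*} [MeasurableSpace Ω] (P : Measure Ω)
    (U : Ω → Metric.sphere (0 : EuclideanSpace ℝ (Fin n)) 1) : Prop :=
  pdf.IsUniform U Set.univ P
    ((volume : Measure (EuclideanSpace ℝ (Fin n))).toSphere)

end

/-! The volume formula is a derivative at `0`. Let `G` be a bounded open convex set and `u` a unit
vector. Each line parallel to `u` that meets `G` does so in an interval, and removing the translate
by `t • u` leaves a piece of length at most `t`, equal to `t` once `t` is small. Fubini and
dominated convergence show that `volume (G \ (G + t • u)) / t` tends to the volume of the shadow of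
`G` (`tendsto_volume_sdiff_translate_div`). For the open unit cube the numerator is `1 - ∏ (1 - t |u
i|)`, whose slope at `0` is `∑ |u i|`. The closed cube has the same shadow volume because a convex
set has null frontier.

For the moments, a product of powers of the `|x i|` is integrated against `exp (-‖x‖ ^ 2)` in two
ways: over coordinates it factors into Gamma values, and in polar coordinates it is the spherical
moment times one Gamma value. Expanding `∑ |u i|` and its square by linearity gives both
expectations. The extrema follow from Cauchy–Schwarz and from `|u i| ^ 2 ≤ |u i|`. -/

/-! ### Shadow volume as a rate of volume loss under translation -/

/-- Fubini coordinates along a unit vector `u` and its orthogonal complement. -/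
theorem measurePreserving_orthogonal_add_smul {E : Type*} [NormedAddCommGroup E]
    [InnerProductSpace ℝ E] [FiniteDimensional ℝ E] [MeasurableSpace E] [BorelSpace E]
    {u : E} (hu : ‖u‖ = 1) :
    MeasurePreserving
      (fun p : (Submodule.span ℝ {u})ᗮ × ℝ => (p.1 : E) + p.2 • u) := by
  have h1 : MeasurePreserving (LinearIsometryEquiv.toSpanUnitSingleton (𝕜 := ℝ) u hu) :=
    LinearIsometryEquiv.measurePreserving _
  have h2 := (Submodule.span ℝ {u}).orthogonalDecomposition.symm.measurePreserving
  have h3 := WithLp.volume_preserving_toLp (Submodule.span ℝ {u}) (Submodule.span ℝ {u})ᗮ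
  have h4 := h2.comp (h3.comp
    (Measure.measurePreserving_swap.comp ((MeasurePreserving.id volume).prod h1)))
  convert h4 using 1
  · ext p
    simp [add_comm]
  · rfl

/-- The part of a bounded interval that is not covered by its translate by `t`. -/
theorem volume_sdiff_translate_le {s : Set ℝ} (hs : Bornology.IsBounded s)
    (hc : s.OrdConnected) {t : ℝ} (ht : 0 ≤ t) : volume (s \ {x | x - t ∈ s}) ≤ ENNReal.ofReal t := by
  -- If `x` lay beyond `sInf s + t`, then `x - t` would sit between two points of `s`, hence in `s`.
  have hsub : s \ {x | x - t ∈ s} ⊆ Set.Icc (sInf s) (sInf s + t) := by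
    rintro x ⟨hx, hxt⟩
    refine ⟨csInf_le hs.bddBelow hx, ?_⟩
    by_contra! h
    obtain ⟨y, hy, hyx⟩ := exists_lt_of_csInf_lt ⟨x, hx⟩ (show sInf s < x - t by linarith)
    exact hxt (hc.out hy hx ⟨hyx.le, by linarith⟩)
  calc _ ≤ volume (Set.Icc (sInf s) (sInf s + t)) := measure_mono hsub
    _ = _ := by simp

-- Below the distance from `sInf s` to a chosen point of `s`, the window of length `t` just above
-- `sInf s` lies in `s`, while shifting it back by `t` takes it below the infimum.
open Filter Topology in
theorem eventually_volume_sdiff_translate_eq {s : Set ℝ} (hs : Bornology.IsBounded s)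
    (ho : IsOpen s) (hc : s.OrdConnected) (hne : s.Nonempty) :
    ∀ᶠ t in 𝓝[>] (0 : ℝ), volume (s \ {x | x - t ∈ s}) = ENNReal.ofReal t := by
  obtain ⟨x, hx⟩ := hne
  have hax : sInf s < x := by
    obtain ⟨ε, hε, hb⟩ := Metric.isOpen_iff.1 ho x hx
    have : x - ε / 2 ∈ s := hb (by simp [abs_of_pos hε]; linarith)
    linarith [csInf_le hs.bddBelow this]
  have : Set.Ioo (0 : ℝ) (x - sInf s) ∈ 𝓝[>] (0 : ℝ) := Ioo_mem_nhdsGT (by linarith)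
  filter_upwards [this] with t ht
  refine le_antisymm (volume_sdiff_translate_le hs hc ht.1.le) ?_
  calc ENNReal.ofReal t = volume (Set.Ioo (sInf s) (sInf s + t)) := by simp
    _ ≤ _ := by
      refine measure_mono ?_
      rintro y ⟨hy1, hy2⟩
      obtain ⟨z, hz, hzy⟩ := exists_lt_of_csInf_lt ⟨x, hx⟩ hy1
      refine ⟨hc.out hz hx ⟨hzy.le, by linarith [ht.2]⟩, fun h => ?_⟩
      have := csInf_le hs.bddBelow h
      linarith

open Filter Topology in
/-- The rate at which a bounded open convex set loses volume when it is compared with its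
translates in a unit direction is the volume of its shadow in that direction. -/
theorem tendsto_volume_sdiff_translate_div {E : Type*} [NormedAddCommGroup E]
    [InnerProductSpace ℝ E] [FiniteDimensional ℝ E] [MeasurableSpace E] [BorelSpace E]
    {u : E} (hu : ‖u‖ = 1) {G : Set E} (hG : IsOpen G) (hconv : Convex ℝ G)
    (hbdd : Bornology.IsBounded G) :
    Tendsto (fun t : ℝ => volume (G \ {x | x - t • u ∈ G}) / ENNReal.ofReal t) (𝓝[>] 0)
      (𝓝 (volume ((Submodule.span ℝ {u})ᗮ.orthogonalProjectionOnto '' G))) := by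
  set V := (Submodule.span ℝ {u})ᗮ with hV
  set fib : V → Set ℝ := fun y => {s | (y : E) + s • u ∈ G} with hfib
  have hproj : ∀ (y : V) (s : ℝ), V.orthogonalProjectionOnto ((y : E) + s • u) = y := by
    intro y s
    rw [map_add, Submodule.orthogonalProjectionOnto_mem_subspace_eq_self, map_smul,
      Submodule.orthogonalProjectionOnto_eq_zero_iff.2, smul_zero,
      add_zero]
    exact Submodule.le_orthogonal_orthogonal _ (Submodule.mem_span_singleton_self u)
  have hmem : ∀ y : V, y ∈ V.orthogonalProjectionOnto '' G ↔ (fib y).Nonempty := by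
    intro y
    constructor
    · rintro ⟨x, hx, rfl⟩
      refine ⟨inner ℝ u x, ?_⟩
      have h := Submodule.starProjection_add_starProjection_orthogonal (K := Submodule.span ℝ {u}) x
      rw [Submodule.starProjection_unit_singleton ℝ hu, add_comm] at h
      change V.starProjection x + _ ∈ G
      rwa [h]
    · rintro ⟨s, hs⟩
      exact ⟨_, hs, hproj y s⟩
  have hfo : ∀ y, IsOpen (fib y) := fun y => hG.preimage (by fun_prop)
  have hfc : ∀ y, (fib y).OrdConnected := by
    intro y
    refine Convex.ordConnected ?_
    intro a ha b hb p q hp hq hpq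
    have := hconv ha hb hp hq hpq
    simp only [hfib, Set.mem_ofPred_eq, smul_eq_mul] at this ⊢
    convert this using 1
    have : (y : E) = (p + q) • (y : E) := by rw [hpq, one_smul]
    nth_rewrite 1 [this]
    module
  have hfb : ∀ y, Bornology.IsBounded (fib y) := by
    intro y
    obtain ⟨C, hC⟩ := hbdd.exists_norm_le
    refine isBounded_iff_forall_norm_le.2 ⟨C + ‖(y : E)‖, fun s hs => ?_⟩
    have h1 := hC _ hs
    have h2 : s • u = ((y : E) + s • u) - y := by abel
    calc ‖s‖ = ‖s • u‖ := by rw [norm_smul, hu, mul_one]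
      _ ≤ _ := by rw [h2]; exact (norm_sub_le _ _).trans (by gcongr)
  have hPo : IsOpen (V.orthogonalProjectionOnto '' G) := by
    refine V.orthogonalProjectionOnto.isOpenMap ?_ G hG
    intro y
    exact ⟨y, by simp⟩
  have hPb : volume (V.orthogonalProjectionOnto '' G) ≠ ⊤ :=
    (V.orthogonalProjectionOnto.lipschitz.isBounded_image hbdd).measure_lt_top.ne
  have hGm : ∀ t : ℝ, MeasurableSet (G \ {x | x - t • u ∈ G}) := fun t =>
    hG.measurableSet.diff (hG.preimage (by fun_prop)).measurableSet
  have hmp := measurePreserving_orthogonal_add_smul hu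
  have hslice : ∀ t : ℝ, ∀ y : V,
      Prod.mk y ⁻¹' ((fun p : V × ℝ => (p.1 : E) + p.2 • u) ⁻¹' (G \ {x | x - t • u ∈ G}))
        = fib y \ {x | x - t ∈ fib y} := by
    intro t y
    ext s
    simp [hfib, sub_smul, add_sub_assoc]
  have hmeas : ∀ t : ℝ, MeasurableSet
      ((fun p : V × ℝ => (p.1 : E) + p.2 • u) ⁻¹' (G \ {x | x - t • u ∈ G})) :=
    fun t => hmp.measurable (hGm t)
  have hvol : ∀ t : ℝ, volume (G \ {x | x - t • u ∈ G})
      = ∫⁻ y : V, volume (fib y \ {x | x - t ∈ fib y}) := by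
    intro t
    rw [← hmp.measure_preimage (hGm t).nullMeasurableSet]
    change (volume.prod volume) _ = _
    rw [Measure.prod_apply (hmeas t)]
    simp_rw [hslice]
  have hfmeas : ∀ t : ℝ, Measurable fun y : V => volume (fib y \ {x | x - t ∈ fib y}) := by
    intro t
    have := measurable_measure_prodMk_left (ν := (volume : Measure ℝ)) (hmeas t)
    simpa only [hslice] using this
  have key : Tendsto (fun t : ℝ => ∫⁻ y : V, volume (fib y \ {x | x - t ∈ fib y}) / ENNReal.ofReal t)
      (𝓝[>] 0) (𝓝 (∫⁻ y : V, (V.orthogonalProjectionOnto '' G).indicator 1 y)) := by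
    -- The quotient on each fibre is at most `1` and vanishes off the shadow, so the indicator of
    -- the shadow is both the dominating function and the limit.
    refine tendsto_lintegral_filter_of_dominated_convergence
      ((V.orthogonalProjectionOnto '' G).indicator 1) ?_ ?_ ?_ ?_
    · exact Eventually.of_forall fun t => (hfmeas t).div_const _
    · filter_upwards [self_mem_nhdsWithin] with t ht
      refine Eventually.of_forall fun y => ?_
      by_cases hy : y ∈ V.orthogonalProjectionOnto '' G
      · rw [Set.indicator_of_mem hy]
        exact ENNReal.div_le_of_le_mul
          (by simpa using volume_sdiff_translate_le (hfb y) (hfc y) (le_of_lt ht))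
      · have : fib y = ∅ := Set.not_nonempty_iff_eq_empty.1 (mt (hmem y).2 hy)
        simp [this]
    · rw [lintegral_indicator_one hPo.measurableSet]
      exact hPb
    · refine Eventually.of_forall fun y => ?_
      by_cases hy : y ∈ V.orthogonalProjectionOnto '' G
      · rw [Set.indicator_of_mem hy]
        refine tendsto_const_nhds.congr' ?_
        filter_upwards [self_mem_nhdsWithin, eventually_volume_sdiff_translate_eq (hfb y) (hfo y)
          (hfc y) ((hmem y).1 hy)] with t ht h
        rw [h, ENNReal.div_self (by simpa using ht) ENNReal.ofReal_ne_top]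
        rfl
      · have : fib y = ∅ := Set.not_nonempty_iff_eq_empty.1 (mt (hmem y).2 hy)
        simp [this, hy]
  rw [lintegral_indicator_one hPo.measurableSet] at key
  refine key.congr fun t => ?_
  simp_rw [div_eq_mul_inv]
  rw [lintegral_mul_const _ (hfmeas t), hvol]

/-! ### The shadow of the cube -/

theorem isOpen_setOf_abs_lt (n : ℕ) (r : ℝ) :
    IsOpen {x : EuclideanSpace ℝ (Fin n) | ∀ i, |x i| < r} := by
  simp only [Set.ofPred_forall]
  exact isOpen_iInter_of_finite fun i => isOpen_lt (by fun_prop) continuous_const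

theorem convex_setOf_abs_lt (n : ℕ) (r : ℝ) :
    Convex ℝ {x : EuclideanSpace ℝ (Fin n) | ∀ i, |x i| < r} := by
  intro x hx y hy a b ha hb hab i
  have h := (convex_Ioo (-r) r) (abs_lt.1 (hx i)) (abs_lt.1 (hy i)) ha hb hab
  exact abs_lt.2 (by simpa using h)

theorem isBounded_setOf_abs_lt (n : ℕ) (r : ℝ) :
    Bornology.IsBounded {x : EuclideanSpace ℝ (Fin n) | ∀ i, |x i| < r} := by
  refine isBounded_iff_forall_norm_le.2 ⟨√(∑ _i : Fin n, r ^ 2), fun x hx => ?_⟩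
  rw [EuclideanSpace.norm_eq]
  gcongr with i
  exact (hx i).le

/-- The open unit cube minus its translate by a small vector `v`. -/
theorem volume_openCube_sdiff_translate {n : ℕ} (v : EuclideanSpace ℝ (Fin n))
    (hv : ∀ i, |v i| ≤ 1) :
    volume ({x : EuclideanSpace ℝ (Fin n) | ∀ i, |x i| < 1 / 2} \
      {x | x - v ∈ {x : EuclideanSpace ℝ (Fin n) | ∀ i, |x i| < 1 / 2}})
      = ENNReal.ofReal (1 - ∏ i, (1 - |v i|)) := by
  set G := {x : EuclideanSpace ℝ (Fin n) | ∀ i, |x i| < 1 / 2} with hG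
  have hbox : ∀ a b : Fin n → ℝ, (∀ i, a i ≤ b i) →
      volume {x : EuclideanSpace ℝ (Fin n) | ∀ i, x i ∈ Set.Ioo (a i) (b i)}
        = ENNReal.ofReal (∏ i, (b i - a i)) := by
    intro a b hab
    have hm : MeasurableSet {x : EuclideanSpace ℝ (Fin n) | ∀ i, x i ∈ Set.Ioo (a i) (b i)} := by
      simp only [Set.ofPred_forall]
      exact MeasurableSet.iInter fun i => measurableSet_Ioo.preimage (by fun_prop)
    rw [← (PiLp.volume_preserving_toLp (Fin n)).measure_preimage hm.nullMeasurableSet]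
    have : WithLp.toLp 2 ⁻¹' {x : EuclideanSpace ℝ (Fin n) | ∀ i, x i ∈ Set.Ioo (a i) (b i)}
        = Set.univ.pi fun i => Set.Ioo (a i) (b i) := by
      ext x; simp
    rw [this, Real.volume_pi_Ioo, ENNReal.ofReal_prod_of_nonneg]
    exact fun i _ => sub_nonneg.2 (hab i)
  have h1 : volume G = 1 := by
    have : G = {x : EuclideanSpace ℝ (Fin n) | ∀ i, x i ∈ Set.Ioo (-(1 / 2) : ℝ) (1 / 2)} := by
      ext x; simp [hG, abs_lt]
    rw [this, hbox _ _ (fun i => by norm_num)]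
    norm_num
  -- The overlap is again a box, with sides `1 - |v i|`.
  have h2 : volume (G ∩ {x | x - v ∈ G}) = ENNReal.ofReal (∏ i, (1 - |v i|)) := by
    have : G ∩ {x | x - v ∈ G} = {x : EuclideanSpace ℝ (Fin n) | ∀ i,
        x i ∈ Set.Ioo (max (-(1 / 2)) (-(1 / 2) + v i)) (min (1 / 2) (1 / 2 + v i))} := by
      ext x
      simp only [hG, Set.mem_inter_iff, Set.mem_ofPred_eq, ← forall_and, abs_lt, Set.mem_Ioo,
        max_lt_iff, lt_min_iff, PiLp.sub_apply]
      refine forall_congr' fun i => ?_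
      constructor
      · rintro ⟨⟨_, _⟩, _, _⟩
        refine ⟨⟨?_, ?_⟩, ?_, ?_⟩ <;> linarith
      · rintro ⟨⟨_, _⟩, _, _⟩
        refine ⟨⟨?_, ?_⟩, ?_, ?_⟩ <;> linarith
    have hlen : ∀ i, min (1 / 2) (1 / 2 + v i) - max (-(1 / 2)) (-(1 / 2) + v i) = 1 - |v i| := by
      intro i
      rcases le_total 0 (v i) with h | h
      · rw [min_eq_left (by linarith), max_eq_right (by linarith), abs_of_nonneg h]; ring
      · rw [min_eq_right (by linarith), max_eq_left (by linarith), abs_of_nonpos h]; ring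
    rw [this, hbox _ _ (fun i => by linarith [hlen i, hv i])]
    simp_rw [hlen]
  have hm : MeasurableSet {x | x - v ∈ G} :=
    ((isOpen_setOf_abs_lt n (1 / 2)).preimage (by fun_prop)).measurableSet
  rw [← Set.sdiff_self_inter, measure_sdiff Set.inter_subset_left
    ((isOpen_setOf_abs_lt n (1 / 2)).measurableSet.inter hm).nullMeasurableSet
    (by rw [h2]; exact ENNReal.ofReal_ne_top), h1, h2,
    ENNReal.ofReal_sub _ (Finset.prod_nonneg fun i _ => by linarith [hv i]), ENNReal.ofReal_one]

theorem abs_apply_le_one {n : ℕ} {u : EuclideanSpace ℝ (Fin n)} (hu : ‖u‖ = 1) (i : Fin n) :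
    |u i| ≤ 1 := by
  simpa [hu] using PiLp.norm_apply_le u i

open Filter Topology in
theorem volume_orthogonalProjection_openCube {n : ℕ} {u : EuclideanSpace ℝ (Fin n)}
    (hu : ‖u‖ = 1) :
    volume ((hyperplane u).orthogonalProjectionOnto ''
      {x : EuclideanSpace ℝ (Fin n) | ∀ i, |x i| < 1 / 2}) = ENNReal.ofReal (∑ i, |u i|) := by
  have h1 := tendsto_volume_sdiff_translate_div hu (isOpen_setOf_abs_lt n (1 / 2))
    (convex_setOf_abs_lt n (1 / 2)) (isBounded_setOf_abs_lt n (1 / 2))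
  refine tendsto_nhds_unique h1 ?_
  -- At `0` every factor equals `1`, so the product rule leaves only the sum of the derivatives.
  have hder : HasDerivAt (fun t : ℝ => 1 - ∏ i, (1 - t * |u i|)) (∑ i, |u i|) 0 := by
    have := (HasDerivAt.fun_finsetProd (u := Finset.univ) (f := fun i (t : ℝ) => 1 - t * |u i|)
      (f' := fun i => -|u i|) (x := 0) (fun i _ => by
        simpa using ((hasDerivAt_id (0 : ℝ)).mul_const |u i|).const_sub 1)).const_sub 1
    simpa using this
  have h2 := hder.tendsto_slope_zero_right
  have h3 := (ENNReal.continuous_ofReal.tendsto _).comp h2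
  refine h3.congr' ?_
  filter_upwards [Ioo_mem_nhdsGT (zero_lt_one' ℝ)] with t ht
  have habs : ∀ i, |(t • u) i| = t * |u i| := fun i => by
    simp [abs_mul, abs_of_pos ht.1]
  have hvol := volume_openCube_sdiff_translate (t • u) fun i => by
    rw [habs]
    exact mul_le_one₀ ht.2.le (abs_nonneg _) (abs_apply_le_one hu i)
  simp only [habs] at hvol
  refine Eq.trans ?_ (congrArg (· / ENNReal.ofReal t) hvol).symm
  rw [← ENNReal.ofReal_div_of_pos ht.1]
  simp [div_eq_inv_mul]

/-- The open unit cube is dense in the closed one, and its shadow is open and convex, so both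
shadows have the same volume. -/
theorem volume_projectedCube {n : ℕ} {u : EuclideanSpace ℝ (Fin n)} (hu : ‖u‖ = 1) :
    volume (projectedCube u) = ENNReal.ofReal (∑ i, |u i|) := by
  rw [← volume_orthogonalProjection_openCube hu]
  set G := {x : EuclideanSpace ℝ (Fin n) | ∀ i, |x i| < 1 / 2} with hG
  set p := (hyperplane u).orthogonalProjectionOnto
  refine le_antisymm ?_ (measure_mono (Set.image_mono fun x hx i => (hx i).le))
  -- Scaling by `t` in `(0, 1)` moves the closed cube into the open one; let `t` tend to `1`.
  have hcl : unitCube n ⊆ closure G := by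
    intro x hx
    have ht : Filter.Tendsto (fun t : ℝ => t • x) (nhdsWithin 1 (Set.Iio 1)) (nhds ((1 : ℝ) • x)) :=
      (Continuous.tendsto (by fun_prop) 1).mono_left nhdsWithin_le_nhds
    rw [one_smul] at ht
    refine mem_closure_of_tendsto ht ?_
    filter_upwards [Ioo_mem_nhdsLT (zero_lt_one' ℝ)] with t ht i
    have hxi : |x i| ≤ 1 / 2 := hx i
    simp only [PiLp.smul_apply, smul_eq_mul, abs_mul, abs_of_pos ht.1]
    nlinarith [ht.1, ht.2, abs_nonneg (x i)]
  have hsub : projectedCube u ⊆ closure (p '' G) :=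
    (Set.image_mono hcl).trans (image_closure_subset_closure_image p.continuous)
  have hconv : Convex ℝ (p '' G) :=
    (convex_setOf_abs_lt n (1 / 2)).linear_image p.toLinearMap
  calc volume (projectedCube u) ≤ volume (closure (p '' G)) := measure_mono hsub
    _ ≤ volume (p '' G ∪ frontier (p '' G)) := by
        rw [closure_eq_self_union_frontier]
    _ ≤ volume (p '' G) + volume (frontier (p '' G)) := measure_union_le _ _
    _ = _ := by rw [hconv.addHaar_frontier volume, add_zero]

theorem vl_eq_sum_abs {n : ℕ} {u : EuclideanSpace ℝ (Fin n)} (hu : ‖u‖ = 1) :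
    vl u = ∑ i, |u i| := by
  rw [vl, volume_projectedCube hu,
    ENNReal.toReal_ofReal (Finset.sum_nonneg fun i _ => abs_nonneg _)]

/-! ### Gaussian integrals and moments on the sphere -/

/-- Integration of a homogeneous function against the Gaussian weight in polar coordinates. -/
theorem integral_homogeneous_mul_exp_neg_norm_sq {E : Type*} [NormedAddCommGroup E]
    [NormedSpace ℝ E] [FiniteDimensional ℝ E] [Nontrivial E] [MeasurableSpace E] [BorelSpace E]
    (μ : Measure E) [μ.IsAddHaarMeasure] {f : E → ℝ} {k : ℕ}
    (hf : ∀ r : ℝ, 0 < r → ∀ x, f (r • x) = r ^ k * f x) :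
    ∫ x, f x * Real.exp (-‖x‖ ^ 2) ∂μ =
      (∫ x, f x.1 ∂μ.toSphere) * (Real.Gamma (((Module.finrank ℝ E + k : ℕ) : ℝ) / 2) / 2) := by
  have hpos : 0 < Module.finrank ℝ E := Module.finrank_pos
  calc ∫ x, f x * Real.exp (-‖x‖ ^ 2) ∂μ
      = ∫ x : ({(0)}ᶜ : Set E), f x.1 * Real.exp (-‖x.1‖ ^ 2) ∂(μ.comap (↑)) := by
        rw [integral_subtype_comap (measurableSet_singleton _).compl
          fun x ↦ f x * Real.exp (-‖x‖ ^ 2), restrict_compl_singleton]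
    _ = ∫ p, f p.1.1 * (p.2.1 ^ k * Real.exp (-p.2.1 ^ 2))
          ∂μ.toSphere.prod (.volumeIoiPow (Module.finrank ℝ E - 1)) := by
        rw [← μ.measurePreserving_homeomorphUnitSphereProd.integral_comp
          (Homeomorph.measurableEmbedding _)]
        refine integral_congr_ae (Filter.Eventually.of_forall fun x => ?_)
        have hx : 0 < ‖x.1‖ := norm_pos_iff.2 x.2
        have h := hf ‖x.1‖ hx (‖x.1‖⁻¹ • x.1)
        rw [smul_inv_smul₀ hx.ne'] at h
        simp only [homeomorphUnitSphereProd_apply_snd_coe, homeomorphUnitSphereProd_apply_fst_coe]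
        rw [h]
        ring
    _ = (∫ x, f x.1 ∂μ.toSphere) * ∫ r : Set.Ioi (0 : ℝ), r.1 ^ k * Real.exp (-r.1 ^ 2)
          ∂.volumeIoiPow (Module.finrank ℝ E - 1) :=
        integral_prod_mul (fun x : Metric.sphere (0 : E) 1 => f x.1)
          (fun r : Set.Ioi (0 : ℝ) => r.1 ^ k * Real.exp (-r.1 ^ 2))
    _ = _ := by
        congr 1
        -- The radial exponent is `k` from homogeneity plus `finrank - 1` from the polar Jacobian.
        have hG := integral_rpow_mul_exp_neg_rpow (p := 2) (q := (Module.finrank ℝ E + k : ℕ) - 1)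
          two_pos (by
            have : (0 : ℝ) < (Module.finrank ℝ E + k : ℕ) := by exact_mod_cast (by omega)
            linarith)
        rw [sub_add_cancel] at hG
        rw [div_eq_inv_mul _ (2 : ℝ), ← one_div, ← hG]
        simp only [Measure.volumeIoiPow, ENNReal.ofReal]
        rw [integral_withDensity_eq_integral_smul (measurable_subtype_coe.pow_const _).real_toNNReal,
          integral_subtype_comap measurableSet_Ioi fun a : ℝ ↦
            Real.toNNReal (a ^ (Module.finrank ℝ E - 1)) • (a ^ k * Real.exp (-a ^ 2))]
        refine setIntegral_congr_fun measurableSet_Ioi fun x hx ↦ ?_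
        have hx' : (0 : ℝ) < x := hx
        have hcast : (((Module.finrank ℝ E + k : ℕ) : ℝ) - 1)
            = ((Module.finrank ℝ E - 1 + k : ℕ) : ℝ) := by
          rw [show Module.finrank ℝ E + k = (Module.finrank ℝ E - 1 + k) + 1 by omega]
          push_cast; ring
        simp only [NNReal.smul_def, Real.coe_toNNReal _ (pow_nonneg hx'.le _), smul_eq_mul]
        rw [hcast, Real.rpow_natCast, Real.rpow_two, pow_add]
        ring

theorem integral_abs_pow_mul_exp_neg_sq (k : ℕ) :
    ∫ x : ℝ, |x| ^ k * Real.exp (-x ^ 2) = Real.Gamma (((k : ℝ) + 1) / 2) := by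
  have h := integral_comp_abs (f := fun x : ℝ => x ^ k * Real.exp (-x ^ 2))
  simp only [sq_abs] at h
  have hG := integral_rpow_mul_exp_neg_rpow (p := 2) (q := k) two_pos
    (by have : (0 : ℝ) ≤ k := k.cast_nonneg
        linarith)
  simp only [Real.rpow_natCast, Real.rpow_two] at hG
  rw [h, hG]
  ring

/-- The absolute monomial moments of the (unnormalized) Gaussian measure. -/
theorem integral_prod_abs_pow_mul_exp_neg_norm_sq {n : ℕ} (a : Fin n → ℕ) :
    ∫ x : EuclideanSpace ℝ (Fin n), (∏ i, |x i| ^ a i) * Real.exp (-‖x‖ ^ 2) =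
      ∏ i, Real.Gamma (((a i : ℝ) + 1) / 2) := by
  rw [← (PiLp.volume_preserving_toLp (Fin n)).integral_comp
    (MeasurableEquiv.toLp 2 (Fin n → ℝ)).measurableEmbedding]
  simp_rw [← integral_abs_pow_mul_exp_neg_sq]
  rw [← integral_fintype_prod_volume_eq_prod
    (fun i (x : ℝ) => |x| ^ a i * Real.exp (-x ^ 2))]
  congr 1
  ext x
  rw [Finset.prod_mul_distrib, ← Real.exp_sum, EuclideanSpace.norm_sq_eq]
  simp

/-- The absolute monomial moments of the surface measure of the sphere. -/
theorem integral_toSphere_prod_abs_pow {n : ℕ} (hn : 1 ≤ n) (a : Fin n → ℕ) :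
    ∫ x, (∏ i, |x.1 i| ^ a i) ∂(volume : Measure (EuclideanSpace ℝ (Fin n))).toSphere =
      2 * (∏ i, Real.Gamma (((a i : ℝ) + 1) / 2)) / Real.Gamma (((n : ℝ) + ∑ i, (a i : ℝ)) / 2) := by
  have : Nontrivial (EuclideanSpace ℝ (Fin n)) := by
    have : Nonempty (Fin n) := ⟨⟨0, hn⟩⟩
    infer_instance
  have h := integral_homogeneous_mul_exp_neg_norm_sq
    (volume : Measure (EuclideanSpace ℝ (Fin n))) (f := fun x => ∏ i, |x i| ^ a i)
    (k := ∑ i, a i) (by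
      intro r hr x
      simp [abs_mul, abs_of_pos hr, mul_pow, Finset.prod_mul_distrib, Finset.prod_pow_eq_pow_sum])
  rw [integral_prod_abs_pow_mul_exp_neg_norm_sq, finrank_euclideanSpace_fin] at h
  push_cast at h
  have hpos : 0 < Real.Gamma (((n : ℝ) + ∑ i, (a i : ℝ)) / 2) := by
    refine Real.Gamma_pos_of_pos (half_pos ?_)
    have : (1 : ℝ) ≤ n := by exact_mod_cast hn
    have : (0 : ℝ) ≤ ∑ i, (a i : ℝ) := Finset.sum_nonneg fun i _ => Nat.cast_nonneg _
    linarith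
  rw [h]
  field_simp

/-- Turns expectations into averages over the surface measure; integrability is automatic for
continuous functions on the compact sphere. -/
theorem IsUniformOnSphere.integrable_comp_and_integral_eq {n : ℕ} (hn : 1 ≤ n)
    {Ω : Type*} [MeasurableSpace Ω]
    {P : Measure Ω} {U : Ω → Metric.sphere (0 : EuclideanSpace ℝ (Fin n)) 1}
    (hU : IsUniformOnSphere P U) {f : Metric.sphere (0 : EuclideanSpace ℝ (Fin n)) 1 → ℝ}
    (hf : Continuous f) :
    Integrable (fun ω => f (U ω)) P ∧ ∫ ω, f (U ω) ∂P =
      (∫ x, f x ∂(volume : Measure (EuclideanSpace ℝ (Fin n))).toSphere) /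
        (volume : Measure (EuclideanSpace ℝ (Fin n))).toSphere.real Set.univ := by
  have : Nontrivial (EuclideanSpace ℝ (Fin n)) := by
    have : Nonempty (Fin n) := ⟨⟨0, hn⟩⟩
    infer_instance
  set σ := (volume : Measure (EuclideanSpace ℝ (Fin n))).toSphere with hσ
  have hσ0 : σ Set.univ ≠ 0 := by
    rw [Ne, Measure.measure_univ_eq_zero]
    exact Measure.toSphere_ne_zero _
  have hm : AEMeasurable U P := pdf.IsUniform.aemeasurable hσ0 (measure_ne_top σ _) hU
  have hmap : P.map U = (σ Set.univ)⁻¹ • σ := by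
    have h : P.map U = cond σ Set.univ := hU
    rw [h, ProbabilityTheory.cond, Measure.restrict_univ]
  have hint : Integrable f σ :=
    hf.integrable_of_hasCompactSupport (HasCompactSupport.of_compactSpace f)
  constructor
  · have : Integrable f (P.map U) := by
      rw [hmap]
      exact hint.smul_measure (ENNReal.inv_ne_top.2 hσ0)
    exact this.comp_aemeasurable hm
  · rw [← integral_map hm hf.aestronglyMeasurable, hmap, integral_smul_measure, ENNReal.toReal_inv,
      smul_eq_mul, Measure.real, div_eq_inv_mul]

/-- The absolute monomial moments of the uniform distribution on the sphere. -/
theorem IsUniformOnSphere.integral_prod_abs_pow {n : ℕ} (hn : 1 ≤ n) {Ω : Type*}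
    [MeasurableSpace Ω] {P : Measure Ω} {U : Ω → Metric.sphere (0 : EuclideanSpace ℝ (Fin n)) 1}
    (hU : IsUniformOnSphere P U) (a : Fin n → ℕ) :
    ∫ ω, ∏ i, |(U ω).1 i| ^ a i ∂P =
      (∏ i, (Real.Gamma (((a i : ℝ) + 1) / 2) / √Real.pi)) *
        (Real.Gamma ((n : ℝ) / 2) / Real.Gamma (((n : ℝ) + ∑ i, (a i : ℝ)) / 2)) := by
  refine (hU.integrable_comp_and_integral_eq hn
    (f := fun x => ∏ i, |x.1 i| ^ a i) (by fun_prop)).2.trans ?_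
  -- The zero exponent vector gives the total surface area, the normalizing constant.
  have hσ := integral_toSphere_prod_abs_pow hn 0
  simp only [Pi.zero_apply, pow_zero, Finset.prod_const_one, integral_const, smul_eq_mul, mul_one,
    Nat.cast_zero, zero_add, Finset.sum_const_zero, add_zero, Finset.prod_const, Finset.card_univ,
    Fintype.card_fin, Real.Gamma_one_half_eq] at hσ
  have hn0 : (0 : ℝ) < n := by exact_mod_cast hn
  have hG : Real.Gamma ((n : ℝ) / 2) ≠ 0 := (Real.Gamma_pos_of_pos (by positivity)).ne'
  have hpi : √Real.pi ≠ 0 := (Real.sqrt_pos.2 Real.pi_pos).ne'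
  rw [integral_toSphere_prod_abs_pow hn a, hσ, Finset.prod_div_distrib, Finset.prod_const,
    Finset.card_univ, Fintype.card_fin]
  field_simp

theorem integral_abs_apply_of_isUniformOnSphere {n : ℕ} (hn : 1 ≤ n) {Ω : Type*}
    [MeasurableSpace Ω] {P : Measure Ω} {U : Ω → Metric.sphere (0 : EuclideanSpace ℝ (Fin n)) 1}
    (hU : IsUniformOnSphere P U) (i : Fin n) :
    ∫ ω, |(U ω).1 i| ∂P =
      1 / √Real.pi * (Real.Gamma ((n : ℝ) / 2) / Real.Gamma (((n : ℝ) + 1) / 2)) := by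
  have h := hU.integral_prod_abs_pow hn (Pi.single i 1)
  have hpi : √Real.pi ≠ 0 := (Real.sqrt_pos.2 Real.pi_pos).ne'
  have hl : ∀ x : EuclideanSpace ℝ (Fin n), ∏ j, |x j| ^ (Pi.single i 1 : Fin n → ℕ) j = |x i| := by
    intro x
    rw [Finset.prod_eq_single i (fun j _ hj => by simp [Pi.single_eq_of_ne hj]) (by simp)]
    simp
  have hs : ∑ j, (((Pi.single i 1 : Fin n → ℕ) j : ℕ) : ℝ) = 1 := by
    rw [← Nat.cast_sum]; simp
  -- Coordinates with exponent `0` contribute `Γ(1/2) / √π = 1`.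
  rw [Finset.prod_eq_single i (fun j _ hj => by
    simp [Pi.single_eq_of_ne hj, -one_div, Real.Gamma_one_half_eq, hpi]) (by simp), hs] at h
  simp only [hl] at h
  simpa [← two_mul] using h

theorem integral_abs_apply_mul_abs_apply_of_isUniformOnSphere {n : ℕ} (hn : 1 ≤ n) {Ω : Type*}
    [MeasurableSpace Ω] {P : Measure Ω} {U : Ω → Metric.sphere (0 : EuclideanSpace ℝ (Fin n)) 1}
    (hU : IsUniformOnSphere P U) (i j : Fin n) :
    ∫ ω, |(U ω).1 i| * |(U ω).1 j| ∂P =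
      if i = j then 1 / (n : ℝ) else 2 / (n * Real.pi) := by
  have hpi : √Real.pi ≠ 0 := (Real.sqrt_pos.2 Real.pi_pos).ne'
  have hn0 : (0 : ℝ) < n := by exact_mod_cast hn
  have hG : Real.Gamma ((n : ℝ) / 2) ≠ 0 := (Real.Gamma_pos_of_pos (by positivity)).ne'
  have hG2 : Real.Gamma (((n : ℝ) + 2) / 2) = (n : ℝ) / 2 * Real.Gamma ((n : ℝ) / 2) := by
    rw [← Real.Gamma_add_one (by positivity)]
    congr 1; ring
  -- One exponent vector serves both cases: it is `2` at `i` when `i = j`, and `1` at each of `i`,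
  -- `j` otherwise.
  have h := hU.integral_prod_abs_pow hn (Pi.single i 1 + Pi.single j 1)
  have hl : ∀ x : EuclideanSpace ℝ (Fin n),
      ∏ k, |x k| ^ (Pi.single i 1 + Pi.single j 1 : Fin n → ℕ) k = |x i| * |x j| := by
    have hs : ∀ (x : EuclideanSpace ℝ (Fin n)) (i : Fin n),
        ∏ k, |x k| ^ (Pi.single i 1 : Fin n → ℕ) k = |x i| := by
      intro x i
      rw [Finset.prod_eq_single i (fun j _ hj => by simp [Pi.single_eq_of_ne hj]) (by simp)]
      simp
    intro x
    simp only [Pi.add_apply, pow_add, Finset.prod_mul_distrib, hs]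
  have hs : ∑ k, (((Pi.single i 1 + Pi.single j 1 : Fin n → ℕ) k : ℕ) : ℝ) = 2 := by
    rw [← Nat.cast_sum]; simp [Finset.sum_add_distrib]
  simp only [hl, hs, hG2] at h
  rw [h]
  split_ifs with hij
  · subst hij
    have h3 : Real.Gamma (3 / 2) = 1 / 2 * √Real.pi := by
      rw [← Real.Gamma_one_half_eq, ← Real.Gamma_add_one (by norm_num)]
      norm_num
    rw [Finset.prod_eq_single i (fun k _ hk => by
      simp [Pi.single_eq_of_ne hk, -one_div, Real.Gamma_one_half_eq, hpi]) (by simp)]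
    simp only [Pi.add_apply, Pi.single_eq_same]
    norm_num [h3]
    field_simp
  · rw [Finset.prod_eq_mul i j hij (fun k _ hk => by
      simp [Pi.single_eq_of_ne hk.1, Pi.single_eq_of_ne hk.2, -one_div, Real.Gamma_one_half_eq,
        hpi]) (by simp) (by simp)]
    have hsq : √Real.pi * √Real.pi = Real.pi := Real.mul_self_sqrt Real.pi_pos.le
    simp only [Pi.add_apply, Pi.single_eq_same, Pi.single_eq_of_ne hij,
      Pi.single_eq_of_ne (Ne.symm hij)]
    norm_num
    rw [← mul_inv, hsq]
    field_simp

/-! ### Expectations of the shadow volume -/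

theorem vl_moments {n : ℕ} (hn : 1 ≤ n) {Ω : Type*}
    [MeasurableSpace Ω] {P : Measure Ω} {U : Ω → Metric.sphere (0 : EuclideanSpace ℝ (Fin n)) 1}
    (hU : IsUniformOnSphere P U) :
    Integrable (fun ω => vl (U ω).1) P ∧
      ∫ ω, vl (U ω).1 ∂P =
        (n : ℝ) / Real.sqrt Real.pi *
          (Real.Gamma ((n : ℝ) / 2) / Real.Gamma (((n : ℝ) + 1) / 2)) ∧
      Integrable (fun ω => vl (U ω).1 ^ 2) P ∧
      ∫ ω, vl (U ω).1 ^ 2 ∂P = 1 + 2 * ((n : ℝ) - 1) / Real.pi := by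
  have hn0 : (0 : ℝ) < n := by exact_mod_cast hn
  have hvl : ∀ ω, vl (U ω).1 = ∑ i, |(U ω).1 i| := fun ω =>
    vl_eq_sum_abs (mem_sphere_zero_iff_norm.1 (U ω).2)
  have hi1 : ∀ i, Integrable (fun ω => |(U ω).1 i|) P := fun i =>
    (hU.integrable_comp_and_integral_eq hn (f := fun x => |x.1 i|) (by fun_prop)).1
  have hi2 : ∀ i j, Integrable (fun ω => |(U ω).1 i| * |(U ω).1 j|) P := fun i j =>
    (hU.integrable_comp_and_integral_eq hn (f := fun x => |x.1 i| * |x.1 j|) (by fun_prop)).1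
  simp only [hvl, sq, Finset.sum_mul_sum]
  refine ⟨integrable_finsetSum _ fun i _ => hi1 i, ?_,
    integrable_finsetSum _ fun i _ => integrable_finsetSum _ fun j _ => hi2 i j, ?_⟩
  · rw [integral_finsetSum _ fun i _ => hi1 i]
    simp only [integral_abs_apply_of_isUniformOnSphere hn hU, Finset.sum_const, Finset.card_univ,
      Fintype.card_fin, nsmul_eq_mul]
    ring
  · rw [integral_finsetSum _ fun i _ => integrable_finsetSum _ fun j _ => hi2 i j]
    have hrow : ∀ i : Fin n, ∫ ω, ∑ j, |(U ω).1 i| * |(U ω).1 j| ∂P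
        = 1 / (n : ℝ) + ((n : ℝ) - 1) * (2 / (n * Real.pi)) := by
      intro i
      rw [integral_finsetSum _ fun j _ => hi2 i j]
      simp only [integral_abs_apply_mul_abs_apply_of_isUniformOnSphere hn hU]
      rw [← Finset.add_sum_erase _ _ (Finset.mem_univ i), if_pos rfl,
        Finset.sum_congr rfl fun j hj => if_neg (Finset.ne_of_mem_erase hj).symm,
        Finset.sum_const, Finset.card_erase_of_mem (Finset.mem_univ i), Finset.card_univ,
        Fintype.card_fin, nsmul_eq_mul, Nat.cast_sub hn, Nat.cast_one]
    simp only [hrow, Finset.sum_const, Finset.card_univ, Fintype.card_fin, nsmul_eq_mul]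
    field_simp

/-! ### Extremal directions: main diagonal and coordinate axis -/

theorem isGreatest_range_vl {n : ℕ} (hn : 1 ≤ n) :
    IsGreatest
      (Set.range fun u : Metric.sphere (0 : EuclideanSpace ℝ (Fin n)) 1 => vl u.1) (√n) := by
  have hn0 : (0 : ℝ) < n := by exact_mod_cast hn
  have hs : 0 < √(n : ℝ) := Real.sqrt_pos.2 hn0
  have hss : √(n : ℝ) * √(n : ℝ) = n := Real.mul_self_sqrt hn0.le
  constructor
  · have hnorm : ‖(WithLp.toLp 2 fun _ => (√(n : ℝ))⁻¹ : EuclideanSpace ℝ (Fin n))‖ = 1 := by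
      rw [EuclideanSpace.norm_eq]
      simp [inv_pow, hn0.ne', Real.sq_sqrt hn0.le]
    refine ⟨⟨_, mem_sphere_zero_iff_norm.2 hnorm⟩, ?_⟩
    simp only [vl_eq_sum_abs hnorm]
    rw [Finset.sum_const, Finset.card_univ, Fintype.card_fin, nsmul_eq_mul,
      abs_of_pos (inv_pos.2 hs), ← div_eq_mul_inv, div_eq_iff hs.ne', hss]
  · rintro _ ⟨u, rfl⟩
    have hu : ‖u.1‖ = 1 := mem_sphere_zero_iff_norm.1 u.2
    simp only [vl_eq_sum_abs hu]
    refine Real.le_sqrt_of_sq_le ?_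
    have h1 : ∑ i, |u.1 i| ^ 2 = 1 := by
      have := EuclideanSpace.norm_sq_eq u.1
      rw [hu] at this
      simpa using this.symm
    -- Cauchy–Schwarz against the constant vector.
    have h := sq_sum_le_card_mul_sum_sq (s := Finset.univ) (f := fun i => |u.1 i|)
    rw [h1] at h
    simpa using h

theorem isLeast_range_vl {n : ℕ} (hn : 1 ≤ n) :
    IsLeast
      (Set.range fun u : Metric.sphere (0 : EuclideanSpace ℝ (Fin n)) 1 => vl u.1) 1 := by
  constructor
  · have hnorm : ‖(EuclideanSpace.single ⟨0, hn⟩ 1 : EuclideanSpace ℝ (Fin n))‖ = 1 := by simp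
    refine ⟨⟨_, mem_sphere_zero_iff_norm.2 hnorm⟩, ?_⟩
    simp only [vl_eq_sum_abs hnorm]
    rw [Finset.sum_eq_single ⟨0, hn⟩ (fun j _ hj => by simp [hj]) (by simp)]
    simp
  · rintro _ ⟨u, rfl⟩
    have hu : ‖u.1‖ = 1 := mem_sphere_zero_iff_norm.1 u.2
    simp only [vl_eq_sum_abs hu]
    have h1 : ∑ i, |u.1 i| ^ 2 = 1 := by
      have := EuclideanSpace.norm_sq_eq u.1
      rw [hu] at this
      simpa using this.symm
    refine h1.symm.le.trans (Finset.sum_le_sum fun i _ => ?_)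
    exact pow_le_of_le_one (abs_nonneg _) (abs_apply_le_one hu i) two_ne_zero


theorem mainTheorem1 :
    -- dimension four
    ((∀ u : Metric.sphere (0 : EuclideanSpace ℝ (Fin 4)) 1,
        vl u.1 = |u.1 0| + |u.1 1| + |u.1 2| + |u.1 3|) ∧
      ∀ (Ω : Type*) [MeasurableSpace Ω] (P : Measure Ω) [IsProbabilityMeasure P]
        (U : Ω → Metric.sphere (0 : EuclideanSpace ℝ (Fin 4)) 1),
        IsUniformOnSphere P U →
          Integrable (fun ω => vl (U ω).1) P ∧
          ∫ ω, vl (U ω).1 ∂P = 16 / (3 * Real.pi) ∧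
          Integrable (fun ω => vl (U ω).1 ^ 2) P ∧
          ∫ ω, vl (U ω).1 ^ 2 ∂P = 1 + 6 / Real.pi) ∧
    -- every dimension
    ∀ n : ℕ, 1 ≤ n →
      (∀ u : Metric.sphere (0 : EuclideanSpace ℝ (Fin n)) 1, vl u.1 = ∑ i, |u.1 i|) ∧
      (∀ (Ω : Type*) [MeasurableSpace Ω] (P : Measure Ω) [IsProbabilityMeasure P]
        (U : Ω → Metric.sphere (0 : EuclideanSpace ℝ (Fin n)) 1),
        IsUniformOnSphere P U →
          Integrable (fun ω => vl (U ω).1) P ∧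
          ∫ ω, vl (U ω).1 ∂P =
            (n : ℝ) / Real.sqrt Real.pi *
              (Real.Gamma ((n : ℝ) / 2) / Real.Gamma (((n : ℝ) + 1) / 2)) ∧
          Integrable (fun ω => vl (U ω).1 ^ 2) P ∧
          ∫ ω, vl (U ω).1 ^ 2 ∂P = 1 + 2 * ((n : ℝ) - 1) / Real.pi) ∧
      IsGreatest
        (Set.range fun u : Metric.sphere (0 : EuclideanSpace ℝ (Fin n)) 1 => vl u.1)
        (Real.sqrt n) ∧
      IsLeast
        (Set.range fun u : Metric.sphere (0 : EuclideanSpace ℝ (Fin n)) 1 => vl u.1)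
        1 := by

  refine ⟨⟨fun u => ?_, fun Ω _ P _ U hU => ?_⟩, fun n hn => ⟨fun u => ?_, fun Ω _ P _ U hU => ?_,
    isGreatest_range_vl hn, isLeast_range_vl hn⟩⟩
  · rw [vl_eq_sum_abs (mem_sphere_zero_iff_norm.1 u.2), Fin.sum_univ_four]
  · obtain ⟨h1, h2, h3, h4⟩ := vl_moments (by norm_num) hU
    refine ⟨h1, h2.trans ?_, h3, h4.trans ?_⟩
    · have h5 : Real.Gamma (5 / 2) = 3 / 4 * √Real.pi := by
        rw [show (5 / 2 : ℝ) = 1 / 2 + 1 + 1 by norm_num, Real.Gamma_add_one (by norm_num),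
          Real.Gamma_add_one (by norm_num), Real.Gamma_one_half_eq]
        ring
      have hpi : √Real.pi ≠ 0 := (Real.sqrt_pos.2 Real.pi_pos).ne'
      have hsq : √Real.pi ^ 2 = Real.pi := Real.sq_sqrt Real.pi_pos.le
      norm_num [h5]
      field_simp
      rw [hsq]
      ring
    · norm_num
  · exact vl_eq_sum_abs (mem_sphere_zero_iff_norm.1 u.2)
  · exact vl_moments hn hU
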